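/- All graphs are finite, simple, undirected and have at least one vertex. Let $0\le\alpha\le 1$, and let $(G_n,d_n)_{n}$ be a sequence in which $d_n\ge 1$ is a real number and $G_n$ is a graph with all degrees at most $d_n$. Assume that - the sequence is $\alpha$-regular: the degree of a uniform random vertex of $G_n$, divided by $d_n$, tends to $\alpha$ in probability as $n\to\infty$; - the sequence has large girth: for every $k\ge 3$ there is an $n_0(k)$ such that for all $n\ge n_0(k)$ there is no injective homomorphism from the cycle $C_k$ to $G_n$; - $d_n\to\infty$. Let $\Sigma_n$ be the uniform probability measure on the points $\lambda/\sqrt{d_n}$, where $\lambda$ runs over the eigenvalues of the adjacency matrix of $G_n$, counted with multiplicity, and let $w(x)=\frac{\sqrt{4-x^2}}{2\pi}$ for $-2\le x\le 2$. Then each $\Sigma_n$ is supported on $[-\sqrt{d_n},\sqrt{d_n}]$, and for each integer $k\ge 0$, $$\int_{-\sqrt{d_n}}^{\sqrt{d_n}}x^k\,\mathrm d\Sigma_n(x)\to\int_{-2}^{2}\left(\sqrt\alpha\,x\right)^k w(x)\,\mathrm dx\qquad(n\to\infty).$$ Moreover, $\Sigma_n$ converges weakly to the semicircle distribution on $[-2\sqrt\alpha,2\sqrt\alpha]$,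 that is, to the distribution of $\sqrt\alpha\,X$, where $X$ is a random variable with density $w$ on $[-2,2]$. -/

import Mathlib

open Filter Topology MeasureTheory
open scoped ENNReal

universe u

/-- The number `inj(F, G)` of injective homomorphisms from `F` to `G`. -/
noncomputable def injCount {W : Type*} {V : Type*} (F : SimpleGraph W) (G : SimpleGraph V) : ℕ :=
  Nat.card {f : F →g G // Function.Injective f}

/-- The pair `(G, d)` is admissible: `d ≥ 1` and all degrees of the finite graph `G` are at
most `d`. -/
def IsAdmissible {V : Type*} [Fintype V] (G : SimpleGraph V) [DecidableRel G.Adj] (d : ℝ) : Prop :=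
  1 ≤ d ∧ ∀ v, (G.degree v : ℝ) ≤ d

/-- The probability that a uniform random element of the finite type `V` satisfies `P`. -/
noncomputable def uniformProb (V : Type*) [Fintype V] (P : V → Prop) : ℝ :=
  (Nat.card {v : V // P v} : ℝ) / (Fintype.card V : ℝ)

/-- The sequence `(G n, d n)` is admissible and `α`-regular: `0 ≤ α ≤ 1`, and the degree of a
uniform random vertex of `G n`, divided by `d n`, tends to `α` in probability. -/
structure IsRegularSeq {V : ℕ → Type u} [∀ n, Fintype (V n)] (G : ∀ n, SimpleGraph (V n))
    [∀ n, DecidableRel (G n).Adj] (d : ℕ → ℝ) (α : ℝ) : Prop where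
  nonneg : 0 ≤ α
  le_one : α ≤ 1
  admissible : ∀ n, IsAdmissible (G n) (d n)
  tendsto_prob : ∀ ε : ℝ, 0 < ε →
    Tendsto (fun n => uniformProb (V n) (fun v => ε ≤ |((G n).degree v : ℝ) / d n - α|))
      atTop (𝓝 0)

/-- The graph sequence `G n` has large girth: for every `k ≥ 3`, `inj(C_k, G n) = 0` for all
sufficiently large `n`. -/
def HasLargeGirth {V : ℕ → Type u} (G : ∀ n, SimpleGraph (V n)) : Prop :=
  ∀ k : ℕ, 3 ≤ k → ∃ n₀ : ℕ, ∀ n : ℕ, n₀ ≤ n → injCount (SimpleGraph.cycleGraph k) (G n) = 0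

theorem adjMatrix_isHermitian_real {V : Type*} (G : SimpleGraph V) [DecidableRel G.Adj] :
    (G.adjMatrix ℝ).IsHermitian := by
  ext i j
  simp [Matrix.conjTranspose_apply, SimpleGraph.adjMatrix_apply, SimpleGraph.adj_comm]

/-- The eigenvalues of (the adjacency matrix of) the finite graph `G`, with multiplicity. -/
noncomputable def graphEigenvalues {V : Type*} [Fintype V] [DecidableEq V] (G : SimpleGraph V)
    [DecidableRel G.Adj] : V → ℝ :=
  (adjMatrix_isHermitian_real G).eigenvalues

/-- The uniform probability measure on the `v(G)` points `l / √d`, where `l` runs over the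
eigenvalues of `G` (with multiplicity). -/
noncomputable def rescaledSpectralMeasure {V : Type*} [Fintype V] [DecidableEq V] [Nonempty V]
    (G : SimpleGraph V) [DecidableRel G.Adj] (d : ℝ) : ProbabilityMeasure ℝ :=
  ⟨(Fintype.card V : ℝ≥0∞)⁻¹ • ∑ i : V, Measure.dirac (graphEigenvalues G i / Real.sqrt d), by
    constructor
    simp only [Measure.smul_apply, Measure.finsetSum_apply, measure_univ, Finset.sum_const,
      Finset.card_univ, nsmul_eq_mul, mul_one, smul_eq_mul]
    exact ENNReal.inv_mul_cancel (by simp) (by simp)⟩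

/-- Wigner's semicircle density on `[-2, 2]`. -/
noncomputable def semicircleDensity (x : ℝ) : ℝ := Real.sqrt (4 - x ^ 2) / (2 * Real.pi)

theorem semicircleDensity_continuous : Continuous semicircleDensity := by
  unfold semicircleDensity
  fun_prop

theorem integral_semicircleDensity : ∫ x in (-2 : ℝ)..2, semicircleDensity x = 1 := by
  have h := intervalIntegral.integral_comp_mul_left (a := -1) (b := 1) semicircleDensity
    (c := (2 : ℝ)) two_ne_zero
  have h2 : ∀ x : ℝ, semicircleDensity (2 * x) = Real.pi⁻¹ * Real.sqrt (1 - x ^ 2) := by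
    intro x
    have : (4 : ℝ) - (2 * x) ^ 2 = 2 ^ 2 * (1 - x ^ 2) := by ring
    rw [semicircleDensity, this, Real.sqrt_mul (by positivity), Real.sqrt_sq (by norm_num)]
    field_simp
  simp only [h2, intervalIntegral.integral_const_mul, integral_sqrt_one_sub_sq] at h
  norm_num at h
  have := Real.pi_ne_zero
  field_simp at h
  linarith

/-- The law on `ℝ` with density `semicircleDensity` on `[-2, 2]`. -/
noncomputable def standardSemicircle : ProbabilityMeasure ℝ :=
  ⟨(volume.restrict (Set.Icc (-2 : ℝ) 2)).withDensity
      (fun x => ENNReal.ofReal (semicircleDensity x)), by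
    constructor
    rw [withDensity_apply _ MeasurableSet.univ, Measure.restrict_univ,
      ← ofReal_integral_eq_lintegral_ofReal, integral_Icc_eq_integral_Ioc,
      ← intervalIntegral.integral_of_le (by norm_num), integral_semicircleDensity,
      ENNReal.ofReal_one]
    · exact semicircleDensity_continuous.continuousOn.integrableOn_Icc
    · exact Eventually.of_forall fun x => by unfold semicircleDensity; positivity⟩

/-- The semicircle distribution on `[-2 * β, 2 * β]`: the distribution of `β * X`, where `X` has
density `semicircleDensity` on `[-2, 2]`. -/
noncomputable def semicircleDistribution (β : ℝ) : ProbabilityMeasure ℝ :=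
  standardSemicircle.map (f := fun x => β * x) (by fun_prop)

/-!
Let `N_j` be the matrix of numbers of paths of length `j`, and let `A` and `D` be the adjacency and
degree matrices. If the girth exceeds `j + 2`, an edge in front of a path of length `j + 1` either
extends the path or retraces its first edge, whence
`A * N_{j+1} = N_{j+2} + (D - min j 1) * N_j` exactly.

Divide the trace of `A ^ p * N_j` by `|V| √d ^ (p + j)`. As `D / d` is close to `α` for most
vertices and `1 / d` tends to `0`, the limits `t p j` satisfy
`t (p + 1) (j + 1) = t p (j + 2) + α * t p j`, and `t 0 j` vanishes for `j ≠ 0` because a closed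
path is trivial. The integrals of `(√α x) ^ p * √α ^ j * S_j(x)` against the semicircle density
satisfy the same relations, by the three-term recurrence and the orthogonality of the Chebyshev
polynomials `S_j`. For `j = 0` this is the convergence of moments, and the semicircle distribution,
being compactly supported, is determined by its moments.
-/

section Girth

theorem injCount_eq_zero_iff {W V : Type*} [Finite W] [Finite V] {F : SimpleGraph W}
    {G : SimpleGraph V} : injCount F G = 0 ↔ F.Free G := by
  have : Finite (F →g G) := DFunLike.finite _
  rw [injCount, Finite.card_eq_zero_iff]
  exact ⟨fun h ⟨f⟩ => h.false ⟨f.toHom, f.injective⟩, fun h => ⟨fun f => h ⟨⟨f.1, f.2⟩⟩⟩⟩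

theorem HasLargeGirth.tendsto_egirth {V : ℕ → Type u} [∀ n, Finite (V n)]
    {G : ∀ n, SimpleGraph (V n)} (hG : HasLargeGirth G) :
    Tendsto (fun n => (G n).egirth) atTop (𝓝 ⊤) := by
  refine ENat.tendsto_nhds_top_iff_natCast_lt.2 fun K => ?_
  have hfree : ∀ k ∈ Finset.Icc 3 K, ∀ᶠ n in atTop, (SimpleGraph.cycleGraph k).Free (G n) := by
    intro k hk
    obtain ⟨n₀, hn₀⟩ := hG k (Finset.mem_Icc.1 hk).1
    exact eventually_atTop.2 ⟨n₀, fun n hn => injCount_eq_zero_iff.1 (hn₀ n hn)⟩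
  filter_upwards [(Finset.eventually_all _).2 hfree] with n hn
  refine (ENat.natCast_lt_natCast.2 K.lt_succ_self).trans_le
    (SimpleGraph.le_egirth.2 fun v c hc => ?_)
  by_contra! hlt
  have hlen : c.length ≤ K := Nat.lt_succ_iff.1 (ENat.natCast_lt_natCast.1 hlt)
  exact hn c.length (Finset.mem_Icc.2 ⟨hc.three_le_length, hlen⟩)
    ((SimpleGraph.cycleGraph_isContained_iff hc.three_le_length).2 ⟨v, c, hc, rfl⟩)

theorem eq_snd_of_length_lt_egirth {V : Type*} {G : SimpleGraph V} {u v w : V} {q : G.Walk u v}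
    (hq : q.IsPath) (hG : ((q.length + 1 : ℕ) : ℕ∞) < G.egirth) (hadj : G.Adj u w)
    (hw : w ∈ q.support) : w = q.snd := by
  classical
  by_contra hne
  have hedge : s(w, u) ∉ (q.takeUntil w hw).edges := fun h =>
    hne (hq.eq_snd_of_mem_edges (Sym2.eq_swap ▸ q.edges_takeUntil_subset_edges hw h))
  have hcycle : ((q.takeUntil w hw).cons hadj.symm).IsCycle :=
    (SimpleGraph.Walk.cons_isCycle_iff _ _).2 ⟨hq.takeUntil hw, hedge⟩
  have hlen : ((q.takeUntil w hw).cons hadj.symm).length ≤ q.length + 1 :=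
    Nat.succ_le_succ (q.length_takeUntil_le_length hw)
  exact hG.not_ge (hcycle.egirth_le_length.trans (ENat.natCast_le_natCast.2 hlen))

end Girth

section Paths

variable {V : Type*} [DecidableEq V] (G : SimpleGraph V) [G.LocallyFinite]

/-- The finite set of paths of length `k` from `u` to `v`. -/
def pathFinset (k : ℕ) (u v : V) : Finset (G.Walk u v) :=
  {p ∈ G.finsetWalkLength k u v | p.IsPath}

variable {G}

theorem mem_pathFinset {k : ℕ} {u v : V} {p : G.Walk u v} :
    p ∈ pathFinset G k u v ↔ p.length = k ∧ p.IsPath := by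
  simp [pathFinset, SimpleGraph.mem_finsetWalkLength_iff]

theorem card_pathFinset_zero (u v : V) : (pathFinset G 0 u v).card = if u = v then 1 else 0 := by
  split_ifs with h
  · subst h
    refine Finset.card_eq_one.2 ⟨SimpleGraph.Walk.nil, ?_⟩
    ext p
    rw [mem_pathFinset, Finset.mem_singleton, SimpleGraph.Walk.length_eq_zero_iff,
      ← SimpleGraph.Walk.eq_nil_iff_nil]
    exact ⟨And.left, by rintro rfl; simp⟩
  · refine Finset.card_eq_zero.2 (Finset.eq_empty_of_forall_notMem fun p hp => ?_)
    exact h (SimpleGraph.Walk.eq_of_length_eq_zero (mem_pathFinset.1 hp).1)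

theorem card_pathFinset_succ_self (k : ℕ) (v : V) : (pathFinset G (k + 1) v v).card = 0 := by
  refine Finset.card_eq_zero.2 (Finset.eq_empty_of_forall_notMem fun p hp => ?_)
  obtain ⟨hlen, hpath⟩ := mem_pathFinset.1 hp
  simp [SimpleGraph.Walk.eq_nil_iff_nil.2 (SimpleGraph.Walk.isPath_iff_nil.1 hpath)] at hlen

theorem card_pathFinset_succ (k : ℕ) (u v : V) :
    (pathFinset G (k + 1) u v).card =
      ∑ w ∈ G.neighborFinset u, {p ∈ pathFinset G k w v | u ∉ p.support}.card := by
  rw [← Finset.card_sigma]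
  symm
  refine Finset.card_bij (fun x hx => x.2.cons
    ((G.mem_neighborFinset u x.1).1 (Finset.mem_sigma.1 hx).1)) ?_ ?_ ?_
  · rintro ⟨w, p⟩ hx
    simp only [Finset.mem_sigma, Finset.mem_filter, mem_pathFinset] at hx
    simp [mem_pathFinset, SimpleGraph.Walk.cons_isPath_iff, hx]
  · rintro ⟨w, p⟩ hx ⟨w', p'⟩ hx' h
    simpa only [SimpleGraph.Walk.cons.injEq, Sigma.mk.injEq] using h
  · intro p hp
    obtain ⟨hlen, hpath⟩ := mem_pathFinset.1 hp
    cases p with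
    | nil => simp at hlen
    | @cons _ w _ hadj q =>
      rw [SimpleGraph.Walk.cons_isPath_iff] at hpath
      rw [SimpleGraph.Walk.length_cons, add_left_inj] at hlen
      refine ⟨⟨w, q⟩, ?_, rfl⟩
      simp [mem_pathFinset, hadj, hpath, hlen]

theorem card_filter_mem_support_pathFinset_succ {k : ℕ} (hG : ((k + 2 : ℕ) : ℕ∞) < G.egirth)
    {u w : V} (hadj : G.Adj u w) (v : V) :
    {p ∈ pathFinset G (k + 1) w v | u ∈ p.support}.card =
      {q ∈ pathFinset G k u v | w ∉ q.support}.card := by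
  symm
  refine Finset.card_bij (fun q _ => q.cons hadj.symm) ?_ ?_ ?_
  · intro q hq
    simp only [Finset.mem_filter, mem_pathFinset] at hq
    simp [mem_pathFinset, SimpleGraph.Walk.cons_isPath_iff, hq]
  · intro q _ q' _ h
    simpa using h
  · intro p hp
    simp only [Finset.mem_filter, mem_pathFinset] at hp
    obtain ⟨⟨hlen, hpath⟩, hu⟩ := hp
    have hsnd : u = p.snd := eq_snd_of_length_lt_egirth hpath (hlen ▸ hG) hadj.symm hu
    cases p with
    | nil => simp at hlen
    | cons h q =>
      rw [SimpleGraph.Walk.snd_cons] at hsnd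
      subst hsnd
      rw [SimpleGraph.Walk.cons_isPath_iff] at hpath
      rw [SimpleGraph.Walk.length_cons, add_left_inj] at hlen
      exact ⟨q, by simp [mem_pathFinset, hlen, hpath], rfl⟩

theorem card_neighborFinset_filter_mem_support {u v : V} {q : G.Walk u v} (hq : q.IsPath)
    (hG : ((q.length + 1 : ℕ) : ℕ∞) < G.egirth) :
    {w ∈ G.neighborFinset u | w ∈ q.support}.card = min q.length 1 := by
  cases q with
  | nil =>
    refine Finset.card_eq_zero.2 (Finset.filter_eq_empty_iff.2 fun w hw => ?_)
    simpa using ((G.mem_neighborFinset u w).1 hw).ne'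
  | @cons _ x _ hadj q =>
    rw [SimpleGraph.Walk.length_cons, min_eq_right (Nat.le_add_left 1 _), Finset.card_eq_one]
    refine ⟨x, Finset.eq_singleton_iff_unique_mem.2 ⟨by simp [hadj], fun w hw => ?_⟩⟩
    obtain ⟨hw, hwq⟩ := Finset.mem_filter.1 hw
    simpa using eq_snd_of_length_lt_egirth hq hG ((G.mem_neighborFinset u w).1 hw) hwq

/-- An edge in front of a path of length `k + 1` either extends it to a path of length `k + 2` or
retraces its first edge; the term `min k 1` accounts for the one neighbour of `u` that lies on a
given path of length `k ≠ 0` from `u`. -/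
theorem sum_card_pathFinset_succ {k : ℕ} (hG : ((k + 2 : ℕ) : ℕ∞) < G.egirth) (u v : V) :
    ∑ w ∈ G.neighborFinset u, (pathFinset G (k + 1) w v).card +
        min k 1 * (pathFinset G k u v).card =
      (pathFinset G (k + 2) u v).card + G.degree u * (pathFinset G k u v).card := by
  have hsplit : ∀ w ∈ G.neighborFinset u, (pathFinset G (k + 1) w v).card =
      {q ∈ pathFinset G k u v | w ∉ q.support}.card +
        {p ∈ pathFinset G (k + 1) w v | u ∉ p.support}.card := fun w hw => by
    rw [← card_filter_mem_support_pathFinset_succ hG ((G.mem_neighborFinset u w).1 hw) v,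
      Finset.card_filter_add_card_filter_not]
  have hdegree : ∀ q ∈ pathFinset G k u v,
      {w ∈ G.neighborFinset u | w ∉ q.support}.card + min k 1 = G.degree u := fun q hq => by
    obtain ⟨rfl, hpath⟩ := mem_pathFinset.1 hq
    have hlt : ((q.length + 1 : ℕ) : ℕ∞) < G.egirth :=
      (ENat.natCast_lt_natCast.2 (Nat.lt_succ_self _)).trans hG
    rw [← card_neighborFinset_filter_mem_support hpath hlt, add_comm,
      Finset.card_filter_add_card_filter_not, G.card_neighborFinset_eq_degree]
  have hcomm : ∑ w ∈ G.neighborFinset u, {q ∈ pathFinset G k u v | w ∉ q.support}.card =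
      ∑ q ∈ pathFinset G k u v, {w ∈ G.neighborFinset u | w ∉ q.support}.card :=
    Finset.sum_card_bipartiteAbove_eq_sum_card_bipartiteBelow
      fun w (q : G.Walk u v) => w ∉ q.support
  rw [Finset.sum_congr rfl hsplit, Finset.sum_add_distrib, ← card_pathFinset_succ, hcomm,
    mul_comm (G.degree u), ← Finset.sum_const_nat hdegree, Finset.sum_add_distrib,
    Finset.sum_const, smul_eq_mul]
  ring

end Paths

section PathMatrix

variable {V : Type*} [DecidableEq V] (G : SimpleGraph V)

section Semiring

variable [G.LocallyFinite] (R : Type*) [Semiring R]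

/-- The matrix whose entry at `(u, v)` is the number of paths of length `k` from `u` to `v`. -/
def pathMatrix (k : ℕ) : Matrix V V R :=
  Matrix.of fun u v => ((pathFinset G k u v).card : R)

theorem pathMatrix_zero : pathMatrix G R 0 = 1 := by
  ext u v
  simp [pathMatrix, card_pathFinset_zero, Matrix.one_apply]

theorem pathMatrix_succ_apply_self (k : ℕ) (v : V) : pathMatrix G R (k + 1) v v = 0 := by
  simp [pathMatrix, card_pathFinset_succ_self]

end Semiring

variable [Fintype V] [DecidableRel G.Adj]

theorem pathMatrix_one (R : Type*) [Semiring R] : pathMatrix G R 1 = G.adjMatrix R := by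
  ext u v
  have hcard : ∀ w ∈ G.neighborFinset u,
      {p ∈ pathFinset G 0 w v | u ∉ p.support}.card = if w = v then 1 else 0 := fun w hw => by
    rw [← card_pathFinset_zero (G := G), Finset.filter_true_of_mem]
    intro p hp
    rw [SimpleGraph.Walk.nil_iff_support_eq.1
      (SimpleGraph.Walk.length_eq_zero_iff.1 (mem_pathFinset.1 hp).1), List.mem_singleton]
    exact ((G.mem_neighborFinset u w).1 hw).ne
  rw [pathMatrix, Matrix.of_apply, card_pathFinset_succ, Finset.sum_congr rfl hcard,
    Finset.sum_ite_eq', SimpleGraph.adjMatrix_apply]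
  simp

variable {G}

theorem adjMatrix_mul_pathMatrix_succ (R : Type*) [Ring R] {k : ℕ}
    (hG : ((k + 2 : ℕ) : ℕ∞) < G.egirth) :
    G.adjMatrix R * pathMatrix G R (k + 1) = pathMatrix G R (k + 2) +
      Matrix.diagonal (fun u => (G.degree u : R) - (min k 1 : ℕ)) * pathMatrix G R k := by
  ext u v
  have h := congrArg (Nat.cast (R := R)) (sum_card_pathFinset_succ hG u v)
  push_cast at h
  simp only [SimpleGraph.adjMatrix_mul_apply, Matrix.add_apply, Matrix.diagonal_mul, pathMatrix,
    Matrix.of_apply, sub_mul]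
  rw [← add_sub_assoc, ← h]
  simp

theorem trace_adjMatrix_pow_succ_mul_pathMatrix_succ (R : Type*) [CommRing R] (p : ℕ) {j : ℕ}
    (hG : ((j + 2 : ℕ) : ℕ∞) < G.egirth) :
    (G.adjMatrix R ^ (p + 1) * pathMatrix G R (j + 1)).trace =
      (G.adjMatrix R ^ p * pathMatrix G R (j + 2)).trace +
        ∑ w, ((G.degree w : R) - (min j 1 : ℕ)) * (pathMatrix G R j * G.adjMatrix R ^ p) w w := by
  rw [pow_succ, Matrix.mul_assoc, adjMatrix_mul_pathMatrix_succ R hG, Matrix.mul_add,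
    Matrix.trace_add, Matrix.trace_mul_comm _ (_ * _), Matrix.mul_assoc]
  simp [Matrix.trace, Matrix.diagonal_mul]

theorem pathMatrix_nonneg (k : ℕ) (u v : V) : 0 ≤ pathMatrix G ℝ k u v := Nat.cast_nonneg _

theorem adjMatrix_pow_nonneg (p : ℕ) (u v : V) : 0 ≤ (G.adjMatrix ℝ ^ p) u v := by
  rw [SimpleGraph.adjMatrix_pow_apply_eq_card_walk]
  exact Nat.cast_nonneg _

theorem pathMatrix_le_adjMatrix_pow (k : ℕ) (u v : V) :
    pathMatrix G ℝ k u v ≤ (G.adjMatrix ℝ ^ k) u v := by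
  rw [SimpleGraph.adjMatrix_pow_apply_eq_card_walk, SimpleGraph.card_set_walk_length_eq]
  exact Nat.cast_le.2 (Finset.card_filter_le _ _)

theorem pathMatrix_mul_adjMatrix_pow_nonneg (p j : ℕ) (u v : V) :
    0 ≤ (pathMatrix G ℝ j * G.adjMatrix ℝ ^ p) u v :=
  Finset.sum_nonneg fun w _ => mul_nonneg (pathMatrix_nonneg j u w) (adjMatrix_pow_nonneg p w v)

theorem IsAdmissible.adjMatrix_pow_succ_mul_pathMatrix_succ_le {d : ℝ} (hd : IsAdmissible G d)
    (p : ℕ) {j : ℕ} (hG : ((j + 2 : ℕ) : ℕ∞) < G.egirth) (u v : V) :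
    (G.adjMatrix ℝ ^ (p + 1) * pathMatrix G ℝ (j + 1)) u v ≤
      (G.adjMatrix ℝ ^ p * pathMatrix G ℝ (j + 2)) u v +
        d * (G.adjMatrix ℝ ^ p * pathMatrix G ℝ j) u v := by
  rw [pow_succ, Matrix.mul_assoc, adjMatrix_mul_pathMatrix_succ ℝ hG, Matrix.mul_add,
    Matrix.add_apply]
  gcongr
  rw [Matrix.mul_apply, Matrix.mul_apply, Finset.mul_sum]
  refine Finset.sum_le_sum fun w _ => ?_
  rw [Matrix.diagonal_mul, mul_left_comm d]
  gcongr
  · exact adjMatrix_pow_nonneg p u w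
  · exact pathMatrix_nonneg j w v
  · exact (sub_le_self _ (Nat.cast_nonneg _)).trans (hd.2 w)

theorem IsAdmissible.adjMatrix_pow_mul_pathMatrix_apply_self_le {d : ℝ} (hd : IsAdmissible G d)
    (p j : ℕ) (hG : ((p + j : ℕ) : ℕ∞) < G.egirth) (v : V) :
    (G.adjMatrix ℝ ^ p * pathMatrix G ℝ j) v v ≤ 2 ^ p * √d ^ (p + j) := by
  induction p generalizing j with
  | zero =>
    cases j with
    | zero => simp [pathMatrix_zero]
    | succ j =>
      rw [pow_zero, one_mul, pathMatrix_succ_apply_self]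
      positivity
  | succ p ih =>
    cases j with
    | zero =>
      calc
        _ = (G.adjMatrix ℝ ^ p * pathMatrix G ℝ 1) v v := by
          rw [pathMatrix_zero, pathMatrix_one, mul_one, pow_succ]
        _ ≤ 2 ^ p * √d ^ (p + 1) := ih 1 hG
        _ ≤ 2 ^ (p + 1) * √d ^ (p + 1 + 0) := by gcongr <;> norm_num
    | succ j =>
      have hlt {m : ℕ} (hm : m ≤ p + j + 2) : (m : ℕ∞) < G.egirth :=
        (ENat.natCast_le_natCast.2 (by omega)).trans_lt hG
      calc
        _ ≤ (G.adjMatrix ℝ ^ p * pathMatrix G ℝ (j + 2)) v v +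
              d * (G.adjMatrix ℝ ^ p * pathMatrix G ℝ j) v v :=
          hd.adjMatrix_pow_succ_mul_pathMatrix_succ_le p (hlt (by omega)) v v
        _ ≤ 2 ^ p * √d ^ (p + (j + 2)) + √d ^ 2 * (2 ^ p * √d ^ (p + j)) := by
          rw [Real.sq_sqrt (zero_le_one.trans hd.1)]
          gcongr
          · exact ih (j + 2) (hlt (by omega))
          · exact zero_le_one.trans hd.1
          · exact ih j (hlt (by omega))
        _ = 2 ^ (p + 1) * √d ^ (p + 1 + (j + 1)) := by ring

theorem IsAdmissible.pathMatrix_mul_adjMatrix_pow_apply_self_le {d : ℝ} (hd : IsAdmissible G d)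
    (p j : ℕ) (hG : ((p + j : ℕ) : ℕ∞) < G.egirth) (v : V) :
    (pathMatrix G ℝ j * G.adjMatrix ℝ ^ p) v v ≤ 2 ^ (p + j) * √d ^ (p + j) := by
  calc
    _ ≤ (G.adjMatrix ℝ ^ j * G.adjMatrix ℝ ^ p) v v :=
      Finset.sum_le_sum fun w _ => mul_le_mul_of_nonneg_right
        (pathMatrix_le_adjMatrix_pow j v w) (adjMatrix_pow_nonneg p w v)
    _ = (G.adjMatrix ℝ ^ (p + j) * pathMatrix G ℝ 0) v v := by
      rw [← pow_add, add_comm, pathMatrix_zero, mul_one]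
    _ ≤ _ := hd.adjMatrix_pow_mul_pathMatrix_apply_self_le (p + j) 0 hG v

end PathMatrix

section ClosedWalkDensity

variable {V : Type*} [Fintype V] [DecidableEq V] (G : SimpleGraph V) [DecidableRel G.Adj]

/-- The number of closed walks of length `p + j` whose last `j` steps form a path, divided by
`|V| √d ^ (p + j)`. -/
noncomputable def closedWalkDensity (d : ℝ) (p j : ℕ) : ℝ :=
  (G.adjMatrix ℝ ^ p * pathMatrix G ℝ j).trace / (Fintype.card V * √d ^ (p + j))

theorem closedWalkDensity_zero_left [Nonempty V] (d : ℝ) (j : ℕ) :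
    closedWalkDensity G d 0 j = if j = 0 then 1 else 0 := by
  cases j with
  | zero => simp [closedWalkDensity, pathMatrix_zero]
  | succ j => simp [closedWalkDensity, Matrix.trace, pathMatrix_succ_apply_self]

theorem closedWalkDensity_succ_zero (d : ℝ) (p : ℕ) :
    closedWalkDensity G d (p + 1) 0 = closedWalkDensity G d p 1 := by
  rw [closedWalkDensity, closedWalkDensity, pathMatrix_zero, pathMatrix_one, mul_one, ← pow_succ,
    add_zero]

variable {G}

theorem closedWalkDensity_succ_succ {d : ℝ} (hd : 0 < d) (α : ℝ) {p j : ℕ}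
    (hG : ((j + 2 : ℕ) : ℕ∞) < G.egirth) :
    closedWalkDensity G d (p + 1) (j + 1) =
      closedWalkDensity G d p (j + 2) + α * closedWalkDensity G d p j +
      (∑ w, ((G.degree w : ℝ) / d - α - (min j 1 : ℕ) / d) *
        ((pathMatrix G ℝ j * G.adjMatrix ℝ ^ p) w w / √d ^ (p + j))) / Fintype.card V := by
  have hs : √d ^ (p + 1 + (j + 1)) = d * √d ^ (p + j) := by
    rw [show p + 1 + (j + 1) = 2 + (p + j) by ring, pow_add, Real.sq_sqrt hd.le]
  have herr : ∑ w, ((G.degree w : ℝ) / d - α - (min j 1 : ℕ) / d) *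
        ((pathMatrix G ℝ j * G.adjMatrix ℝ ^ p) w w / √d ^ (p + j)) =
      (∑ w, ((G.degree w : ℝ) - (min j 1 : ℕ)) * (pathMatrix G ℝ j * G.adjMatrix ℝ ^ p) w w) /
          √d ^ (p + 1 + (j + 1)) -
        α * (G.adjMatrix ℝ ^ p * pathMatrix G ℝ j).trace / √d ^ (p + j) := by
    rw [Matrix.trace_mul_comm, Matrix.trace, Finset.mul_sum, Finset.sum_div, Finset.sum_div,
      ← Finset.sum_sub_distrib, hs]
    refine Finset.sum_congr rfl fun w _ => ?_
    rw [Matrix.diag_apply]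
    field_simp
    ring
  rw [herr, closedWalkDensity, closedWalkDensity, closedWalkDensity,
    trace_adjMatrix_pow_succ_mul_pathMatrix_succ ℝ p hG,
    show p + (j + 2) = p + 1 + (j + 1) by ring]
  field_simp
  ring

theorem IsAdmissible.abs_closedWalkDensity_succ_succ_sub_le [Nonempty V] {d : ℝ}
    (hd : IsAdmissible G d) (α : ℝ) {p j : ℕ} (hG : ((p + j + 2 : ℕ) : ℕ∞) < G.egirth) :
    |closedWalkDensity G d (p + 1) (j + 1) -
        (closedWalkDensity G d p (j + 2) + α * closedWalkDensity G d p j)| ≤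
      2 ^ (p + j) * ((∑ w, |(G.degree w : ℝ) / d - α|) / Fintype.card V + 1 / d) := by
  have hd0 : 0 < d := zero_lt_one.trans_le hd.1
  have hlt {m : ℕ} (hm : m ≤ p + j + 2) : (m : ℕ∞) < G.egirth :=
    (ENat.natCast_le_natCast.2 hm).trans_lt hG
  have hterm (w : V) : |((G.degree w : ℝ) / d - α - (min j 1 : ℕ) / d) *
      ((pathMatrix G ℝ j * G.adjMatrix ℝ ^ p) w w / √d ^ (p + j))| ≤
      (|(G.degree w : ℝ) / d - α| + 1 / d) * 2 ^ (p + j) := by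
    rw [abs_mul]
    gcongr
    · refine (abs_sub _ _).trans ?_
      rw [abs_of_nonneg (a := ((min j 1 : ℕ) : ℝ) / d) (by positivity)]
      gcongr
      exact_mod_cast min_le_right j 1
    · rw [abs_of_nonneg (div_nonneg (pathMatrix_mul_adjMatrix_pow_nonneg p j w w) (by positivity)),
        div_le_iff₀ (by positivity)]
      exact hd.pathMatrix_mul_adjMatrix_pow_apply_self_le p j (hlt (by omega)) w
  rw [closedWalkDensity_succ_succ hd0 α (hlt (by omega)), add_sub_cancel_left, abs_div,
    Nat.abs_cast]
  calc
    _ ≤ (∑ w, (|(G.degree w : ℝ) / d - α| + 1 / d) * 2 ^ (p + j)) / Fintype.card V := by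
      gcongr
      exact (Finset.abs_sum_le_sum_abs _ _).trans (Finset.sum_le_sum fun w _ => hterm w)
    _ = _ := by
      rw [← Finset.sum_mul, Finset.sum_add_distrib, Finset.sum_const, Finset.card_univ,
        nsmul_eq_mul, mul_div_right_comm, add_div,
        mul_div_cancel_left₀ _ (Nat.cast_ne_zero.2 Fintype.card_ne_zero), mul_comm]

end ClosedWalkDensity

section Semicircle

theorem semicircleDensity_nonneg (x : ℝ) : 0 ≤ semicircleDensity x := by
  unfold semicircleDensity
  positivity

theorem semicircleDensity_two_mul_cos {θ : ℝ} (hθ : 0 ≤ Real.sin θ) :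
    semicircleDensity (2 * Real.cos θ) = Real.sin θ / Real.pi := by
  have hsq : 4 - (2 * Real.cos θ) ^ 2 = (2 * Real.sin θ) ^ 2 := by
    linear_combination -4 * Real.sin_sq_add_cos_sq θ
  rw [semicircleDensity, hsq, Real.sqrt_sq (by positivity), mul_div_mul_left _ _ two_ne_zero]

theorem integral_mul_semicircleDensity {f : ℝ → ℝ} (hf : Continuous f) :
    ∫ x in (-2 : ℝ)..2, f x * semicircleDensity x =
      2 / Real.pi * ∫ θ in (0 : ℝ)..Real.pi, f (2 * Real.cos θ) * Real.sin θ ^ 2 := by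
  have hsubst := intervalIntegral.integral_comp_mul_deriv (a := Real.pi) (b := 0)
    (f := fun θ => 2 * Real.cos θ) (fun θ _ => (Real.hasDerivAt_cos θ).const_mul 2) (by fun_prop)
    (g := fun x => f x * semicircleDensity x) (hf.mul semicircleDensity_continuous)
  simp only [Real.cos_pi, Real.cos_zero, mul_neg, mul_one] at hsubst
  rw [← hsubst, intervalIntegral.integral_symm, ← intervalIntegral.integral_neg,
    ← intervalIntegral.integral_const_mul]
  refine intervalIntegral.integral_congr fun θ hθ => ?_
  rw [Set.uIcc_of_le Real.pi_pos.le] at hθ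
  simp only [Function.comp_apply,
    semicircleDensity_two_mul_cos (Real.sin_nonneg_of_nonneg_of_le_pi hθ.1 hθ.2)]
  ring

theorem integral_cos_nat_mul (k : ℕ) :
    ∫ θ in (0 : ℝ)..Real.pi, Real.cos (k * θ) = if k = 0 then Real.pi else 0 := by
  split_ifs with hk
  · simp [hk]
  · rw [intervalIntegral.integral_comp_mul_left _ (Nat.cast_ne_zero.2 hk), integral_cos]
    simp [Real.sin_nat_mul_pi]

theorem integral_chebyshevS_mul_semicircleDensity (j : ℕ) :
    ∫ x in (-2 : ℝ)..2, (Polynomial.Chebyshev.S ℝ j).eval x * semicircleDensity x =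
      if j = 0 then 1 else 0 := by
  have hS (θ : ℝ) : (Polynomial.Chebyshev.S ℝ j).eval (2 * Real.cos θ) * Real.sin θ ^ 2 =
      2⁻¹ * (Real.cos (j * θ) - Real.cos ((j + 2 : ℕ) * θ)) := by
    have h := Polynomial.Chebyshev.S_two_mul_real_cos θ j
    rw [show (j : ℝ) * θ = (j + 1) * θ - θ by ring,
      show ((j + 2 : ℕ) : ℝ) * θ = (j + 1) * θ + θ by push_cast; ring, Real.cos_add, Real.cos_sub]
    push_cast at h
    linear_combination Real.sin θ * h
  have hcos (k : ℕ) : IntervalIntegrable (fun θ : ℝ => Real.cos (k * θ)) volume 0 Real.pi :=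
    Continuous.intervalIntegrable (by fun_prop) _ _
  rw [integral_mul_semicircleDensity (Polynomial.continuous _)]
  simp_rw [hS]
  rw [intervalIntegral.integral_const_mul, intervalIntegral.integral_sub (hcos _) (hcos _),
    integral_cos_nat_mul, integral_cos_nat_mul]
  rcases eq_or_ne j 0 with rfl | hj
  · simp only [↓reduceIte, Nat.reduceAdd, OfNat.ofNat_ne_zero, sub_zero]
    field_simp
  · simp [hj]

/-- The integral of `(β x) ^ p` times the rescaled Chebyshev polynomial `β ^ j S_j(x)` against the
semicircle density, the limiting value of `closedWalkDensity` with `β = √α`. The polynomials `S_j`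
are those with `S_j(2 cos θ) sin θ = sin ((j + 1) θ)`. -/
noncomputable def semicircleChebyshevMoment (β : ℝ) (p j : ℕ) : ℝ :=
  ∫ x in (-2 : ℝ)..2, (β * x) ^ p * (β ^ j * (Polynomial.Chebyshev.S ℝ j).eval x) *
    semicircleDensity x

theorem semicircleChebyshevMoment_zero_left (β : ℝ) (j : ℕ) :
    semicircleChebyshevMoment β 0 j = if j = 0 then 1 else 0 := by
  simp only [semicircleChebyshevMoment, pow_zero, one_mul, mul_assoc]
  rw [intervalIntegral.integral_const_mul, integral_chebyshevS_mul_semicircleDensity]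
  split_ifs with hj <;> simp [hj]

theorem semicircleChebyshevMoment_zero_right (β : ℝ) (p : ℕ) :
    semicircleChebyshevMoment β p 0 = ∫ x in (-2 : ℝ)..2, (β * x) ^ p * semicircleDensity x := by
  simp [semicircleChebyshevMoment]

theorem semicircleChebyshevMoment_succ_zero (β : ℝ) (p : ℕ) :
    semicircleChebyshevMoment β (p + 1) 0 = semicircleChebyshevMoment β p 1 := by
  simp [semicircleChebyshevMoment, pow_succ]

theorem semicircleChebyshevMoment_succ_succ (β : ℝ) (p j : ℕ) :
    semicircleChebyshevMoment β (p + 1) (j + 1) =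
      semicircleChebyshevMoment β p (j + 2) + β ^ 2 * semicircleChebyshevMoment β p j := by
  have hint (j : ℕ) : IntervalIntegrable (fun x : ℝ => (β * x) ^ p *
      (β ^ j * (Polynomial.Chebyshev.S ℝ j).eval x) * semicircleDensity x) volume (-2) 2 :=
    have := semicircleDensity_continuous
    Continuous.intervalIntegrable (by fun_prop) _ _
  unfold semicircleChebyshevMoment
  rw [← intervalIntegral.integral_const_mul,
    ← intervalIntegral.integral_add (hint _) ((hint _).const_mul _)]
  congr 1 with x
  push_cast
  rw [Polynomial.Chebyshev.S_add_two]
  simp only [Polynomial.eval_sub, Polynomial.eval_mul, Polynomial.eval_X]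
  ring

theorem integral_standardSemicircle (f : ℝ → ℝ) :
    ∫ x, f x ∂(standardSemicircle : Measure ℝ) =
      ∫ x in (-2 : ℝ)..2, f x * semicircleDensity x := by
  change ∫ x, f x ∂((volume.restrict (Set.Icc (-2 : ℝ) 2)).withDensity
    fun x => ENNReal.ofReal (semicircleDensity x)) = _
  rw [integral_withDensity_eq_integral_toReal_smul
    semicircleDensity_continuous.measurable.ennreal_ofReal (by simp),
    integral_Icc_eq_integral_Ioc, ← intervalIntegral.integral_of_le (by norm_num)]
  simp [ENNReal.toReal_ofReal (semicircleDensity_nonneg _), mul_comm]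

theorem integral_pow_semicircleDistribution (β : ℝ) (k : ℕ) :
    ∫ x, x ^ k ∂(semicircleDistribution β : Measure ℝ) =
      ∫ x in (-2 : ℝ)..2, (β * x) ^ k * semicircleDensity x := by
  rw [semicircleDistribution, ProbabilityMeasure.toMeasure_map,
    integral_map (by fun_prop) (by fun_prop), integral_standardSemicircle]

theorem abs_le_ae_standardSemicircle : ∀ᵐ x ∂(standardSemicircle : Measure ℝ), |x| ≤ 2 := by
  change ∀ᵐ x ∂((volume.restrict (Set.Icc (-2 : ℝ) 2)).withDensity
    fun x => ENNReal.ofReal (semicircleDensity x)), |x| ≤ 2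
  exact (withDensity_absolutelyContinuous _ _).ae_le
    ((ae_restrict_mem measurableSet_Icc).mono fun x hx => abs_le.2 hx)

theorem abs_le_ae_semicircleDistribution (β : ℝ) :
    ∀ᵐ x ∂(semicircleDistribution β : Measure ℝ), |x| ≤ 2 * |β| := by
  rw [semicircleDistribution, ProbabilityMeasure.toMeasure_map,
    ae_map_iff (by fun_prop) (measurableSet_le (by fun_prop) (by fun_prop))]
  filter_upwards [abs_le_ae_standardSemicircle] with x hx
  rw [abs_mul, mul_comm]
  gcongr

end Semicircle

section Moments

theorem norm_sub_taylorWithinEval_univ_le {E : Type*} [NormedAddCommGroup E] [NormedSpace ℝ E]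
    [CompleteSpace E] {f : ℝ → E} {n : ℕ} {C : ℝ} (hf : ContDiff ℝ (n + 1 : ℕ) f)
    (x₀ x : ℝ)
    (hC : ∀ y ∈ Set.uIcc x₀ x, ‖iteratedDeriv (n + 1) f y‖ ≤ C) :
    ‖f x - taylorWithinEval f n Set.univ x₀ x‖ ≤ C * |x - x₀| ^ (n + 1) / n.factorial := by
  rcases eq_or_ne x₀ x with rfl | hne
  · simp
  have hderiv {k : ℕ} (hk : k ≤ n + 1) {t : ℝ} (ht : t ∈ Set.uIcc x₀ x) :
      iteratedDerivWithin k f (Set.uIcc x₀ x) t = iteratedDeriv k f t :=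
    iteratedDerivWithin_eq_iteratedDeriv (uniqueDiffOn_uIcc hne)
      (hf.contDiffAt.of_le (by exact_mod_cast hk)) ht
  have htaylor : taylorWithinEval f n Set.univ x₀ x =
      taylorWithinEval f n (Set.uIcc x₀ x) x₀ x := by
    rw [taylor_within_apply, taylor_within_apply]
    refine Finset.sum_congr rfl fun k hk => ?_
    rw [hderiv (Finset.mem_range.1 hk).le Set.left_mem_uIcc, iteratedDerivWithin_univ]
  rw [htaylor, taylor_integral_remainder hf.contDiffOn]
  refine (intervalIntegral.norm_integral_le_of_norm_le_const
    (C := |x - x₀| ^ n / n.factorial * C) fun t ht => ?_).trans_eq (by ring)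
  have ht' := Set.uIoc_subset_uIcc ht
  have hdist : |x - t| ≤ |x - x₀| := Set.abs_sub_right_of_mem_uIcc ht'
  have hCt := hC t ht'
  rw [hderiv le_rfl ht', norm_smul, norm_div, norm_pow, Real.norm_eq_abs, Real.norm_natCast]
  gcongr

theorem norm_iteratedDeriv_charFun_le {μ : Measure ℝ} [IsFiniteMeasure μ] {n : ℕ}
    (hint : MemLp id n μ) (t : ℝ) :
    ‖iteratedDeriv n (charFun μ) t‖ ≤ ∫ x, |x| ^ n ∂μ := by
  rw [iteratedDeriv_charFun hint, norm_mul, norm_pow, Complex.norm_I, one_pow, one_mul]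
  refine (norm_integral_le_integral_norm _).trans_eq (integral_congr_ae (.of_forall fun x => ?_))
  simp only [norm_mul]
  rw [← Complex.ofReal_mul, Complex.norm_exp_ofReal_mul_I]
  simp

/-- The partial sum, with terms of degree at most `n`, of the expansion of the characteristic
function of `μ` at `t` in the moments of `μ`. -/
noncomputable def charFunMomentSum (μ : Measure ℝ) (n : ℕ) (t : ℝ) : ℂ :=
  ∑ k ∈ Finset.range (n + 1),
    (k.factorial : ℂ)⁻¹ * (t * Complex.I) ^ k * ((∫ x, x ^ k ∂μ : ℝ) : ℂ)

theorem norm_charFun_sub_charFunMomentSum_le {μ : Measure ℝ} [IsFiniteMeasure μ] {n : ℕ}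
    (hint : MemLp id (n + 1 : ℕ) μ) (t : ℝ) :
    ‖charFun μ t - charFunMomentSum μ n t‖ ≤
      (∫ x, |x| ^ (n + 1) ∂μ) * |t| ^ (n + 1) / n.factorial := by
  have h := norm_sub_taylorWithinEval_univ_le (contDiff_charFun hint) 0 t
    fun y _ => norm_iteratedDeriv_charFun_le hint y
  rwa [taylorWithinEval_charFun_zero
    (hint.mono_exponent (Nat.cast_le.2 n.le_succ)), sub_zero] at h

theorem integral_abs_pow_le_of_ae_abs_le {μ : Measure ℝ} [IsProbabilityMeasure μ] {C : ℝ}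
    (hC : ∀ᵐ x ∂μ, |x| ≤ C) (k : ℕ) : ∫ x, |x| ^ k ∂μ ≤ C ^ k := by
  have hpow : ∀ᵐ x ∂μ, ‖|x| ^ k‖ ≤ C ^ k := by
    filter_upwards [hC] with x hx
    rw [norm_pow, Real.norm_eq_abs, abs_abs]
    gcongr
  simpa using (le_abs_self _).trans (norm_integral_le_of_norm_le_const hpow)

theorem exists_odd_pow_succ_div_factorial_lt (c : ℝ) {ε : ℝ} (hε : 0 < ε) :
    ∃ m : ℕ, Odd m ∧ c ^ (m + 1) / m.factorial < ε := by
  have hlt : ∀ᶠ m : ℕ in atTop, c * (c ^ m / m.factorial) < ε :=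
    ((FloorSemiring.tendsto_pow_div_factorial_atTop c).const_mul c).eventually_lt_const
      (by simpa using hε)
  obtain ⟨m, hm, hodd⟩ := (hlt.and_frequently Nat.frequently_odd).exists
  exact ⟨m, hodd, by rwa [pow_succ', mul_div_assoc]⟩

theorem tendsto_charFun_of_tendsto_moments {ι : Type*} {l : Filter ι} {μ : ι → Measure ℝ}
    [∀ i, IsFiniteMeasure (μ i)] {ν : Measure ℝ} [IsProbabilityMeasure ν] {C : ℝ}
    (hμ : ∀ i, ∀ k : ℕ, MemLp id k (μ i)) (hν : ∀ᵐ x ∂ν, |x| ≤ C)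
    (hlim : ∀ k : ℕ, Tendsto (fun i => ∫ x, x ^ k ∂μ i) l (𝓝 (∫ x, x ^ k ∂ν))) (t : ℝ) :
    Tendsto (fun i => charFun (μ i) t) l (𝓝 (charFun ν t)) := by
  have hνmem (k : ℕ) : MemLp id k ν := .of_bound aestronglyMeasurable_id C hν
  rw [Metric.tendsto_nhds]
  intro ε hε
  obtain ⟨m, hodd, hm⟩ :=
    exists_odd_pow_succ_div_factorial_lt (C * |t|) (ε := ε / 3) (by positivity)
  rw [mul_pow] at hm
  have habs (ρ : Measure ℝ) : ∫ x, |x| ^ (m + 1) ∂ρ = ∫ x, x ^ (m + 1) ∂ρ := by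
    simp_rw [(hodd.add_odd odd_one).pow_abs]
  have hνm : (∫ x, |x| ^ (m + 1) ∂ν) * |t| ^ (m + 1) / m.factorial < ε / 3 := by
    refine lt_of_le_of_lt ?_ hm
    gcongr
    exact integral_abs_pow_le_of_ae_abs_le hν _
  have hμm : ∀ᶠ i in l,
      (∫ x, |x| ^ (m + 1) ∂μ i) * |t| ^ (m + 1) / m.factorial < ε / 3 := by
    simp only [habs] at hνm ⊢
    exact (((hlim (m + 1)).mul_const _).div_const _).eventually_lt_const hνm
  have hsum : Tendsto (fun i => charFunMomentSum (μ i) m t) l (𝓝 (charFunMomentSum ν m t)) :=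
    tendsto_finsetSum _ fun k _ => ((hlim k).ofReal).const_mul _
  filter_upwards [hμm, Metric.tendsto_nhds.1 hsum (ε / 3) (by positivity)] with i hi hdist
  calc
    dist (charFun (μ i) t) (charFun ν t)
      ≤ dist (charFun (μ i) t) (charFunMomentSum (μ i) m t) +
          dist (charFunMomentSum (μ i) m t) (charFunMomentSum ν m t) +
          dist (charFunMomentSum ν m t) (charFun ν t) := dist_triangle4 _ _ _ _
    _ < ε / 3 + ε / 3 + ε / 3 := by
      rw [dist_eq_norm (charFun (μ i) t), dist_comm _ (charFun ν t), dist_eq_norm (charFun ν t)]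
      gcongr
      · exact (norm_charFun_sub_charFunMomentSum_le (hμ i _) t).trans_lt hi
      · exact (norm_charFun_sub_charFunMomentSum_le (hνmem _) t).trans_lt hνm
    _ = ε := by ring

theorem tendsto_of_tendsto_moments {μ : ℕ → ProbabilityMeasure ℝ} {ν : ProbabilityMeasure ℝ}
    {C : ℝ} (hμ : ∀ n k : ℕ, MemLp id k (μ n : Measure ℝ))
    (hν : ∀ᵐ x ∂(ν : Measure ℝ), |x| ≤ C)
    (hlim : ∀ k : ℕ, Tendsto (fun n => ∫ x, x ^ k ∂(μ n : Measure ℝ)) atTop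
      (𝓝 (∫ x, x ^ k ∂(ν : Measure ℝ)))) :
    Tendsto μ atTop (𝓝 ν) :=
  ProbabilityMeasure.tendsto_iff_tendsto_charFun.2
    (tendsto_charFun_of_tendsto_moments hμ hν hlim)

end Moments

section Limits

theorem sum_div_card_le_add_uniformProb {V : Type*} [Fintype V] [Nonempty V] {f : V → ℝ}
    (hf : ∀ v, f v ≤ 1) {ε : ℝ} (hε : 0 ≤ ε) :
    (∑ v, f v) / Fintype.card V ≤ ε + uniformProb V (fun v => ε ≤ f v) := by
  classical
  have hV : (Fintype.card V : ℝ) ≠ 0 := Nat.cast_ne_zero.2 Fintype.card_ne_zero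
  calc
    _ ≤ (∑ v, (ε + if ε ≤ f v then 1 else 0)) / Fintype.card V := by
      gcongr with v
      split_ifs with h
      · linarith [hf v]
      · linarith
    _ = _ := by
      rw [Finset.sum_add_distrib, Finset.sum_const, Finset.card_univ, nsmul_eq_mul, add_div,
        mul_div_cancel_left₀ _ hV, uniformProb, Nat.card_eq_fintype_card, Fintype.card_subtype,
        Finset.sum_boole]

theorem IsAdmissible.abs_degree_div_sub_le_one {V : Type*} [Fintype V] {G : SimpleGraph V}
    [DecidableRel G.Adj] {d α : ℝ} (hd : IsAdmissible G d) (hα₀ : 0 ≤ α) (hα₁ : α ≤ 1) (v : V) :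
    |(G.degree v : ℝ) / d - α| ≤ 1 := by
  have hd0 : 0 < d := zero_lt_one.trans_le hd.1
  have hle : (G.degree v : ℝ) / d ≤ 1 := (div_le_one hd0).2 (hd.2 v)
  have hnonneg : 0 ≤ (G.degree v : ℝ) / d := by positivity
  exact abs_le.2 ⟨by linarith, by linarith⟩

variable {V : ℕ → Type u} [∀ n, Fintype (V n)] [∀ n, Nonempty (V n)] {G : ∀ n, SimpleGraph (V n)}
  [∀ n, DecidableRel (G n).Adj] {d : ℕ → ℝ} {α : ℝ}

theorem IsRegularSeq.tendsto_avg_abs_degree_sub (hreg : IsRegularSeq G d α) :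
    Tendsto (fun n => (∑ w, |((G n).degree w : ℝ) / d n - α|) / Fintype.card (V n)) atTop
      (𝓝 0) := by
  refine tendsto_order.2 ⟨fun a ha => .of_forall fun n => ha.trans_le (by positivity),
    fun ε hε => ?_⟩
  filter_upwards [(hreg.tendsto_prob (ε / 2) (half_pos hε)).eventually_lt_const (half_pos hε)]
    with n hn
  have havg := sum_div_card_le_add_uniformProb
    ((hreg.admissible n).abs_degree_div_sub_le_one hreg.nonneg hreg.le_one) (half_pos hε).le
  linarith

theorem IsRegularSeq.tendsto_closedWalkDensity_succ_succ_sub [∀ n, DecidableEq (V n)]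
    (hreg : IsRegularSeq G d α) (hgirth : HasLargeGirth G) (hd : Tendsto d atTop atTop)
    (p j : ℕ) :
    Tendsto (fun n => closedWalkDensity (G n) (d n) (p + 1) (j + 1) -
      (closedWalkDensity (G n) (d n) p (j + 2) + α * closedWalkDensity (G n) (d n) p j)) atTop
      (𝓝 0) := by
  have hbound : Tendsto (fun n => 2 ^ (p + j) *
      ((∑ w, |((G n).degree w : ℝ) / d n - α|) / Fintype.card (V n) + 1 / d n)) atTop (𝓝 0) := by
    simpa using (hreg.tendsto_avg_abs_degree_sub.add
      (tendsto_const_nhds (x := (1 : ℝ)).div_atTop hd)).const_mul (2 ^ (p + j))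
  refine squeeze_zero_norm' ?_ hbound
  filter_upwards [ENat.tendsto_nhds_top_iff_natCast_lt.1 hgirth.tendsto_egirth (p + j + 2)]
    with n hn
  exact (hreg.admissible n).abs_closedWalkDensity_succ_succ_sub_le α hn

theorem IsRegularSeq.tendsto_closedWalkDensity [∀ n, DecidableEq (V n)]
    (hreg : IsRegularSeq G d α) (hgirth : HasLargeGirth G) (hd : Tendsto d atTop atTop)
    (p j : ℕ) :
    Tendsto (fun n => closedWalkDensity (G n) (d n) p j) atTop
      (𝓝 (semicircleChebyshevMoment (√α) p j)) := by
  induction p generalizing j with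
  | zero =>
    simp only [closedWalkDensity_zero_left, semicircleChebyshevMoment_zero_left]
    exact tendsto_const_nhds
  | succ p ih =>
    cases j with
    | zero =>
      simp only [closedWalkDensity_succ_zero, semicircleChebyshevMoment_succ_zero]
      exact ih 1
    | succ j =>
      rw [semicircleChebyshevMoment_succ_succ, Real.sq_sqrt hreg.nonneg]
      simpa using (hreg.tendsto_closedWalkDensity_succ_succ_sub hgirth hd p j).add
        ((ih (j + 2)).add ((ih j).const_mul α))

end Limits

section SpectralMeasure

variable {V : Type*} [Fintype V] [DecidableEq V]

theorem sum_eigenvalues_pow_eq_trace_pow {𝕜 : Type*} [RCLike 𝕜] {A : Matrix V V 𝕜}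
    (hA : A.IsHermitian) (k : ℕ) : ∑ i, (hA.eigenvalues i : 𝕜) ^ k = (A ^ k).trace := by
  conv_rhs => rw [hA.spectral_theorem, ← map_pow, Matrix.diagonal_pow]
  rw [Unitary.conjStarAlgAut_apply, Matrix.trace_mul_cycle, Unitary.coe_star_mul_self, one_mul,
    Matrix.trace_diagonal]
  simp

variable (G : SimpleGraph V) [DecidableRel G.Adj]

variable {G} in
theorem IsAdmissible.abs_graphEigenvalues_le {d : ℝ} (hd : IsAdmissible G d) (i : V) :
    |graphEigenvalues G i| ≤ d := by
  have heigen : Module.End.HasEigenvalue (Matrix.toLin' (G.adjMatrix ℝ))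
      (graphEigenvalues G i) := by
    rw [Module.End.hasEigenvalue_iff_mem_spectrum, Matrix.spectrum_toLin']
    exact (adjMatrix_isHermitian_real G).eigenvalues_mem_spectrum_real i
  obtain ⟨v, hv⟩ := eigenvalue_mem_ball heigen
  rw [SimpleGraph.adjMatrix_apply, if_neg G.irrefl, mem_closedBall_zero_iff,
    Real.norm_eq_abs] at hv
  calc
    |graphEigenvalues G i| ≤ ∑ w ∈ Finset.univ.erase v, ‖G.adjMatrix ℝ v w‖ := hv
    _ ≤ ∑ w, ‖G.adjMatrix ℝ v w‖ :=
      Finset.sum_le_sum_of_subset_of_nonneg (Finset.subset_univ _) fun _ _ _ => norm_nonneg _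
    _ = G.degree v := by
      simp [SimpleGraph.adjMatrix_apply, apply_ite, ← SimpleGraph.card_neighborFinset_eq_degree,
        SimpleGraph.neighborFinset_eq_filter]
    _ ≤ d := hd.2 v

variable [Nonempty V]

theorem coe_rescaledSpectralMeasure (d : ℝ) :
    (rescaledSpectralMeasure G d : Measure ℝ) =
      (Fintype.card V : ℝ≥0∞)⁻¹ • ∑ i, Measure.dirac (graphEigenvalues G i / √d) := rfl

theorem integral_pow_rescaledSpectralMeasure (d : ℝ) (k : ℕ) :
    ∫ x, x ^ k ∂(rescaledSpectralMeasure G d : Measure ℝ) = closedWalkDensity G d k 0 := by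
  have htrace : ∑ i, graphEigenvalues G i ^ k = (G.adjMatrix ℝ ^ k).trace :=
    sum_eigenvalues_pow_eq_trace_pow (adjMatrix_isHermitian_real G) k
  rw [coe_rescaledSpectralMeasure, integral_smul_measure,
    integral_finsetSum_measure fun i _ => integrable_dirac (by simp), closedWalkDensity,
    pathMatrix_zero, mul_one, add_zero, ← htrace]
  simp only [integral_dirac, div_pow, ← Finset.sum_div, ENNReal.toReal_inv, ENNReal.toReal_natCast,
    smul_eq_mul]
  rw [← div_eq_inv_mul, div_div, mul_comm]

variable {G} in
theorem IsAdmissible.rescaledSpectralMeasure_compl_Icc {d : ℝ} (hd : IsAdmissible G d) :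
    (rescaledSpectralMeasure G d : Measure ℝ) (Set.Icc (-√d) √d)ᶜ = 0 := by
  have hd0 : 0 < d := zero_lt_one.trans_le hd.1
  have hmem (i : V) : graphEigenvalues G i / √d ∈ Set.Icc (-√d) √d := by
    rw [Set.mem_Icc, ← abs_le, abs_div, abs_of_pos (Real.sqrt_pos.2 hd0),
      div_le_iff₀ (Real.sqrt_pos.2 hd0), Real.mul_self_sqrt hd0.le]
    exact hd.abs_graphEigenvalues_le i
  rw [coe_rescaledSpectralMeasure, Measure.smul_apply, Measure.finsetSum_apply,
    Finset.sum_eq_zero, smul_zero]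
  intro i _
  rw [Measure.dirac_apply' _ measurableSet_Icc.compl,
    Set.indicator_of_notMem (Set.notMem_compl_iff.2 (hmem i))]

end SpectralMeasure

theorem mainTheorem9 {V : ℕ → Type u} [∀ n, Fintype (V n)] [∀ n, DecidableEq (V n)]
    [∀ n, Nonempty (V n)] (G : ∀ n, SimpleGraph (V n)) [∀ n, DecidableRel (G n).Adj]
    (d : ℕ → ℝ) (α : ℝ) (hreg : IsRegularSeq G d α) (hgirth : HasLargeGirth G)
    (hd : Tendsto d atTop atTop) :
    (∀ n, (rescaledSpectralMeasure (G n) (d n) : Measure ℝ)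
        (Set.Icc (-Real.sqrt (d n)) (Real.sqrt (d n)))ᶜ = 0) ∧
    (∀ k : ℕ, Tendsto
      (fun n => ∫ x in Set.Icc (-Real.sqrt (d n)) (Real.sqrt (d n)),
        x ^ k ∂(rescaledSpectralMeasure (G n) (d n) : Measure ℝ))
      atTop (𝓝 (∫ x in (-2 : ℝ)..2, (Real.sqrt α * x) ^ k * semicircleDensity x))) ∧
    Tendsto (fun n => rescaledSpectralMeasure (G n) (d n)) atTop
      (𝓝 (semicircleDistribution (Real.sqrt α))) := by
  have hsupp (n : ℕ) : ∀ᵐ x ∂(rescaledSpectralMeasure (G n) (d n) : Measure ℝ),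
      x ∈ Set.Icc (-√(d n)) √(d n) :=
    mem_ae_iff.2 (hreg.admissible n).rescaledSpectralMeasure_compl_Icc
  have hmom (k : ℕ) : Tendsto
      (fun n => ∫ x, x ^ k ∂(rescaledSpectralMeasure (G n) (d n) : Measure ℝ))
      atTop (𝓝 (∫ x in (-2 : ℝ)..2, (√α * x) ^ k * semicircleDensity x)) := by
    simp_rw [integral_pow_rescaledSpectralMeasure, ← semicircleChebyshevMoment_zero_right]
    exact hreg.tendsto_closedWalkDensity hgirth hd k 0
  refine ⟨fun n => (hreg.admissible n).rescaledSpectralMeasure_compl_Icc, fun k => ?_,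
    tendsto_of_tendsto_moments (fun n k => ?_) (abs_le_ae_semicircleDistribution √α) fun k => ?_⟩
  · simp_rw [Measure.restrict_eq_self_of_ae_mem (hsupp _)]
    exact hmom k
  · exact .of_bound aestronglyMeasurable_id _ ((hsupp n).mono fun x hx => abs_le.2 hx)
  · rw [integral_pow_semicircleDistribution]
    exact hmom k
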